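/- Let $a,b\ge 2$ be coprime integers such that $d:=ab$ is not a perfect square. Let $\sqrt d=[a_0,a_1,a_2,\dots]$ be the continued fraction expansion of $\sqrt d$, let $p_n/q_n$ ($n\ge 0$) be its $n$-th convergent in lowest terms, and let $T\ge 1$ be the smallest period of this expansion, i.e. the least $T\ge1$ such that $a_{n+T}=a_n$ for all sufficiently large $n$. Let $(x_n)_{n\ge0}$ be the complete quotients of $x:=\lfloor\sqrt d\rfloor+\sqrt d$, i.e. $x_0=x$ and $x_{n+1}=1/(x_n-\lfloor x_n\rfloor)$, and let $(u_n)$, $(v_n)$ be the sequences of integers such that $x_n=(u_n+\sqrt d)/v_n$ for all $n\ge0$; they are given by $u_0=\lfloor\sqrt d\rfloor$, $v_0=1$, $u_{n+1}=\lfloor x_n\rfloor v_n-u_n$ and $v_{n+1}=(d-u_{n+1}^2)/v_n$. Put $N=T/2$ and consider the equation $$(E_2)\colon\quad ax^2-by^2=1,\qquad (x,y)\in\mathbb N^2 .$$ 1. If $a<b$, then $(E_2)$ has a solution if and only if $T\equiv 0\pmod 4$, $v_N=a$ and $v_N\mid u_N$. Moreover, in this case, the set of solutions of $(E_2)$ is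 $\left\{\left(\frac{p_{N-1+\ell T}}{a},\,q_{N-1+\ell T}\right)\;\middle|\;\ell\in\mathbb N\right\}$. 2. If $b<a$, then $(E_2)$ has a solution if and only if $T\equiv 2\pmod 4$, $v_N=b$ and $v_N\mid u_N$. Moreover, in this case, the set of solutions of $(E_2)$ is $\left\{\left(q_{N-1+\ell T},\,\frac{p_{N-1+\ell T}}{b}\right)\;\middle|\;\ell\in\mathbb N\right\}$. 3. In particular, $(E_2)$ has no solution if $T$ is odd. Here $\mathbb N=\{0,1,2,\dots\}$. -/

import Mathlib

namespace SqrtContFrac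

/-- The `n`-th complete quotient `x_n` of the real number `x`: `x_0 = x` and
`x_{n+1} = 1 / (x_n - ⌊x_n⌋)`, read off from Mathlib's stream of pairs `(⌊x_n⌋, x_n - ⌊x_n⌋)`.
(It is `0` once the algorithm has stopped, which never happens for irrational `x`.) -/
noncomputable def completeQuotient (x : ℝ) (n : ℕ) : ℝ :=
  ((GenContFract.IntFractPair.stream x n).map fun s => (s.b : ℝ) + s.fr).getD 0

/-- The `n`-th partial quotient `a_n = ⌊x_n⌋` of the continued fraction expansion of `x`. -/
noncomputable def partialQuotient (x : ℝ) (n : ℕ) : ℤ :=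
  ((GenContFract.IntFractPair.stream x n).map fun s => s.b).getD 0

/-- `T` is a period of the continued fraction expansion of `x`: `T ≥ 1` and `a_{n+T} = a_n`
for all `n` from some rank on. -/
def IsPeriod (x : ℝ) (T : ℕ) : Prop :=
  0 < T ∧ ∃ n₀ : ℕ, ∀ n, n₀ ≤ n → partialQuotient x (n + T) = partialQuotient x n

/-- The smallest period of the continued fraction expansion of `x`
(`0` if the expansion is not periodic, which never happens for quadratic irrationals). -/
noncomputable def minPeriod (x : ℝ) : ℕ := sInf {T : ℕ | IsPeriod x T}

/-- The pairs `(u_n, v_n)` attached to `√d`. With `(x_n)` the complete quotients of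
`⌊√d⌋ + √d` and `a'_n = ⌊x_n⌋`: `u_0 = ⌊√d⌋`, `v_0 = 1`, `u_{n+1} = a'_n v_n - u_n` and
`v_{n+1} = (d - u_{n+1}^2) / v_n`. The division is exact when `d` is not a perfect square, and
then `x_n = (u_n + √d) / v_n`: see `completeQuotient_eq` below. -/
noncomputable def uv (d : ℕ) : ℕ → ℤ × ℤ
  | 0 => (⌊√(d : ℝ)⌋, 1)
  | n + 1 =>
    let u' := partialQuotient (⌊√(d : ℝ)⌋ + √(d : ℝ)) n * (uv d n).2 - (uv d n).1
    (u', ((d : ℤ) - u' ^ 2) / (uv d n).2)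

/-- The sequence `(u_n)` attached to `√d`. -/
noncomputable def u (d n : ℕ) : ℤ := (uv d n).1

/-- The sequence `(v_n)` attached to `√d`. -/
noncomputable def v (d n : ℕ) : ℤ := (uv d n).2

theorem v_ne_zero_and_dvd {d : ℕ} (hd : ¬ IsSquare d) (n : ℕ) :
    v d n ≠ 0 ∧ v d n ∣ (d : ℤ) - u d n ^ 2 := by
  have hsq : ∀ z : ℤ, (d : ℤ) - z ^ 2 ≠ 0 := fun z hz =>
    hd ⟨z.natAbs, by zify; rw [← pow_two, sq_abs]; linarith⟩
  induction n with
  | zero => simp [v, uv]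
  | succ n ih =>
    obtain ⟨h0, k, hk⟩ := ih
    set A := partialQuotient (⌊√(d : ℝ)⌋ + √(d : ℝ)) n with hA
    have hu : u d (n + 1) = A * v d n - u d n := rfl
    have hv : v d (n + 1) = ((d : ℤ) - u d (n + 1) ^ 2) / v d n := rfl
    have hdvd : v d n ∣ (d : ℤ) - u d (n + 1) ^ 2 :=
      ⟨k - A ^ 2 * v d n + 2 * A * u d n, by rw [hu]; linear_combination hk⟩
    have hmul : v d (n + 1) * v d n = (d : ℤ) - u d (n + 1) ^ 2 := by
      rw [hv]; exact Int.ediv_mul_cancel hdvd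
    refine ⟨fun h => hsq (u d (n + 1)) (by rw [← hmul, h, zero_mul]), v d n, hmul.symm⟩

/-- The sequences `(u_n)` and `(v_n)` are the integers with `x_n = (u_n + √d) / v_n`, where
`(x_n)` are the complete quotients of `⌊√d⌋ + √d`. -/
theorem completeQuotient_eq {d : ℕ} (hd : ¬ IsSquare d) (n : ℕ) :
    completeQuotient (⌊√(d : ℝ)⌋ + √(d : ℝ)) n = (u d n + √(d : ℝ)) / v d n := by
  have hirr : Irrational √(d : ℝ) := irrational_sqrt_natCast_iff.mpr hd
  set x : ℝ := ⌊√(d : ℝ)⌋ + √(d : ℝ) with hx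
  have key : ∀ n, GenContFract.IntFractPair.stream x n =
      some (GenContFract.IntFractPair.of ((u d n + √(d : ℝ)) / v d n)) := by
    intro n
    induction n with
    | zero => simp [u, v, uv, GenContFract.IntFractPair.stream_zero, hx]
    | succ n ih =>
      obtain ⟨h0, -⟩ := v_ne_zero_and_dvd hd n
      obtain ⟨h1, -⟩ := v_ne_zero_and_dvd hd (n + 1)
      have h0' : (v d n : ℝ) ≠ 0 := by exact_mod_cast h0
      have h1' : (v d (n + 1) : ℝ) ≠ 0 := by exact_mod_cast h1
      have hA : partialQuotient x n = ⌊(u d n + √(d : ℝ)) / v d n⌋ := by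
        simp [partialQuotient, ih, GenContFract.IntFractPair.of]
      have hu : u d (n + 1) = partialQuotient x n * v d n - u d n := rfl
      have hmul : v d (n + 1) * v d n = (d : ℤ) - u d (n + 1) ^ 2 := by
        refine Int.ediv_mul_cancel ?_
        obtain ⟨-, k, hk⟩ := v_ne_zero_and_dvd hd n
        change v d n ∣ (d : ℤ) - u d (n + 1) ^ 2
        refine ⟨k - partialQuotient x n ^ 2 * v d n + 2 * partialQuotient x n * u d n, ?_⟩
        rw [hu]; linear_combination hk
      have hmulR : (v d (n + 1) : ℝ) * v d n = (d : ℝ) - (u d (n + 1) : ℝ) ^ 2 := by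
        exact_mod_cast hmul
      have huR : (u d (n + 1) : ℝ) = partialQuotient x n * v d n - u d n := by
        exact_mod_cast hu
      have hsub : √(d : ℝ) - u d (n + 1) ≠ 0 := fun h =>
        hirr.ne_int (u d (n + 1)) (by linarith)
      have hfr : (GenContFract.IntFractPair.of ((u d n + √(d : ℝ)) / v d n)).fr =
          (√(d : ℝ) - u d (n + 1)) / v d n := by
        simp only [GenContFract.IntFractPair.of, Int.fract, ← hA]
        rw [huR]; field_simp; ring
      have hs : √(d : ℝ) ^ 2 = d := Real.sq_sqrt (Nat.cast_nonneg d)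
      rw [GenContFract.IntFractPair.stream_succ_of_some ih
        (by rw [hfr]; exact div_ne_zero hsub h0'), hfr]
      congr 2
      rw [inv_div, div_eq_div_iff hsub h1']
      linear_combination hmulR - hs
  simp [completeQuotient, key n, GenContFract.IntFractPair.of]

/-- The set of solutions `(x, y) ∈ ℕ²` of `a x² - b y² = 1` (an equation between integers). -/
def solutions (a b : ℕ) : Set (ℕ × ℕ) :=
  {s | (a : ℤ) * (s.1 : ℤ) ^ 2 - (b : ℤ) * (s.2 : ℤ) ^ 2 = 1}

/-- The numerator `p_n` of the `n`-th convergent `p_n / q_n` of `√d`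
(`p_0 = a_0`, `p_1 = a_1 a_0 + 1`, `p_n = a_n p_{n-1} + p_{n-2}`), as a real number. -/
noncomputable def p (d n : ℕ) : ℝ := (GenContFract.of √(d : ℝ)).nums n

/-- The denominator `q_n` of the `n`-th convergent `p_n / q_n` of `√d`
(`q_0 = 1`, `q_1 = a_1`, `q_n = a_n q_{n-1} + q_{n-2}`), as a real number. -/
noncomputable def q (d n : ℕ) : ℝ := (GenContFract.of √(d : ℝ)).dens n

end SqrtContFrac

/-!
Multiplying `a x² - b y² = 1` by the smaller coefficient `c` of the two turns a solution into a
primitive solution of `X² - d Y² = ± c`, where `X` is `c` times one of the unknowns and `c < √d`.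
By Legendre's theorem (`exists_eq_num_den`) `X / Y` is then a convergent of `√d`. The identity
`p_{m-1}² - d q_{m-1}² = (-1)^m v_m` (`num_sq_sub_mul_den_sq`) gives the sign and `v_m = c`, and
`p_{m-1} = u_m q_{m-1} + v_m q_{m-2}` (`num_den_eq`) shows that `c ∣ p_{m-1}` exactly when
`v_m ∣ u_m`; see `solution_iff`.

It remains to locate such indices `m`. All complete quotients `x_n = (u_n + √d) / v_n` are reduced,
so that `⌊x_n⌋` is also the integer part of `-1 / x_{n+1}'` (`quot_eq_floor_succ`): the algorithm
runs backwards by the same rule. Hence the sequence `(x_n)` is purely periodic, and `v_m = 1` holds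
exactly for the multiples `m` of the smallest period `T` (`v_eq_one_iff_minPeriod_dvd`). If
`v_m ∣ u_m`, then `u_{m+1} = u_m` and the sequences are symmetric about `m` (`uv_symm`), whence
`v_{2m} = v_0 = 1` and `T ∣ 2 m`. As `v_m = c ≠ 1`, `T` does not divide `m`; so `T` is even and
`m ≡ T / 2` modulo `T` (`exists_eq_half_add_mul`). The parity of `m` is that of `T / 2`, which gives
the residue of `T` modulo `4`.
-/

namespace SqrtContFrac

/-! ### The recurrence for `(u_n, v_n)` and the partial quotients -/

/-- The integer part `⌊x_n⌋` of the `n`-th complete quotient `x_n` of `⌊√d⌋ + √d`. -/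
noncomputable def quot (d n : ℕ) : ℤ := partialQuotient (⌊√(d : ℝ)⌋ + √(d : ℝ)) n

theorem u_zero (d : ℕ) : u d 0 = ⌊√(d : ℝ)⌋ := rfl

theorem v_zero (d : ℕ) : v d 0 = 1 := rfl

theorem u_succ (d n : ℕ) : u d (n + 1) = quot d n * v d n - u d n := rfl

theorem v_succ_mul {d : ℕ} (hd : ¬ IsSquare d) (n : ℕ) :
    v d (n + 1) * v d n = d - u d (n + 1) ^ 2 := by
  obtain ⟨-, k, hk⟩ := v_ne_zero_and_dvd hd n
  have hdvd : v d n ∣ (d : ℤ) - u d (n + 1) ^ 2 :=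
    ⟨k - quot d n ^ 2 * v d n + 2 * quot d n * u d n, by
      rw [u_succ]; linear_combination hk⟩
  exact Int.ediv_mul_cancel hdvd

theorem irrational_sqrt {d : ℕ} (hd : ¬ IsSquare d) : Irrational √(d : ℝ) :=
  irrational_sqrt_natCast_iff.mpr hd

theorem completeQuotient_ne_zero {d : ℕ} (hd : ¬ IsSquare d) (n : ℕ) :
    completeQuotient (⌊√(d : ℝ)⌋ + √(d : ℝ)) n ≠ 0 := by
  rw [completeQuotient_eq hd]
  refine div_ne_zero (fun h => (irrational_sqrt hd).ne_int (-u d n) ?_)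
    (by exact_mod_cast (v_ne_zero_and_dvd hd n).1)
  push_cast
  linarith

theorem exists_stream_eq {d : ℕ} (hd : ¬ IsSquare d) (n : ℕ) :
    ∃ s, GenContFract.IntFractPair.stream (⌊√(d : ℝ)⌋ + √(d : ℝ)) n = some s ∧
      s.b = quot d n := by
  have h := completeQuotient_ne_zero hd n
  rw [completeQuotient] at h
  rw [quot, partialQuotient]
  cases hs : GenContFract.IntFractPair.stream (⌊√(d : ℝ)⌋ + √(d : ℝ)) n with
  | none => rw [hs] at h; exact absurd rfl h
  | some s => exact ⟨s, rfl, by simp⟩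

theorem quot_eq_floor {d : ℕ} (hd : ¬ IsSquare d) (n : ℕ) :
    quot d n = ⌊(u d n + √(d : ℝ)) / v d n⌋ := by
  obtain ⟨s, hs, hb⟩ := exists_stream_eq hd n
  have h := GenContFract.IntFractPair.nth_stream_fr_nonneg_lt_one hs
  rw [← completeQuotient_eq hd, completeQuotient, hs, ← hb]
  symm
  rw [Int.floor_eq_iff]
  simp only [Option.map_some, Option.getD_some]
  constructor <;> linarith [h.1, h.2]

/-- The expansions of `√d` and of `⌊√d⌋ + √d` agree after the first term, as both numbers have
the same fractional part. -/
theorem stream_sqrt_succ {d : ℕ} (hd : ¬ IsSquare d) (n : ℕ) :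
    ∃ s, GenContFract.IntFractPair.stream √(d : ℝ) (n + 1) = some s ∧
      s.b = quot d (n + 1) := by
  obtain ⟨s, hs, hb⟩ := exists_stream_eq hd (n + 1)
  refine ⟨s, ?_, hb⟩
  have h0 : Int.fract √(d : ℝ) ≠ 0 := fun h =>
    (irrational_sqrt hd).ne_int ⌊√(d : ℝ)⌋ (by linarith [Int.floor_add_fract √(d : ℝ)])
  rw [GenContFract.IntFractPair.stream_succ (by rwa [Int.fract_intCast_add]),
    Int.fract_intCast_add] at hs
  rw [GenContFract.IntFractPair.stream_succ h0, hs]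

theorem partialQuotient_sqrt_succ {d : ℕ} (hd : ¬ IsSquare d) (n : ℕ) :
    partialQuotient √(d : ℝ) (n + 1) = quot d (n + 1) := by
  obtain ⟨s, hs, hb⟩ := stream_sqrt_succ hd n
  simp [partialQuotient, hs, hb]

/-- The complete quotients `x_n = (u_n + √d) / v_n` are reduced: in terms of the conjugate
`x_n' = (u_n - √d) / v_n`, the inequalities say that `v_n > 0`, `-1 < x_n' < 0` and `1 < x_n`. -/
theorem reduced {d : ℕ} (hd : ¬ IsSquare d) (n : ℕ) :
    0 < (v d n : ℝ) ∧ (u d n : ℝ) < √(d : ℝ) ∧ √(d : ℝ) - u d n < v d n ∧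
      (v d n : ℝ) < √(d : ℝ) + u d n := by
  have hs : √(d : ℝ) ^ 2 = d := Real.sq_sqrt (Nat.cast_nonneg d)
  induction n with
  | zero =>
    have h1 : (⌊√(d : ℝ)⌋ : ℝ) < √(d : ℝ) := lt_of_le_of_ne (Int.floor_le _)
      ((irrational_sqrt hd).ne_int _).symm
    have h2 := Int.lt_floor_add_one √(d : ℝ)
    have h3 : (1 : ℝ) ≤ √(d : ℝ) := by
      rw [Real.one_le_sqrt]
      exact_mod_cast Nat.one_le_iff_ne_zero.mpr fun h => hd ⟨0, h⟩
    have h4 : (1 : ℝ) ≤ (⌊√(d : ℝ)⌋ : ℝ) := by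
      exact_mod_cast Int.le_floor.mpr (by exact_mod_cast h3)
    rw [u_zero, v_zero]
    push_cast
    refine ⟨one_pos, h1, by linarith, by linarith⟩
  | succ n ih =>
    obtain ⟨hv, hu, h1, h2⟩ := ih
    have hq := quot_eq_floor hd n
    have hq1 : (1 : ℝ) ≤ quot d n := by
      have : (1 : ℤ) ≤ quot d n := by
        rw [hq, Int.le_floor, le_div_iff₀ hv]
        push_cast
        linarith
      exact_mod_cast this
    have hu' : (u d (n + 1) : ℝ) = quot d n * v d n - u d n := by exact_mod_cast u_succ d n
    have hv' : (v d (n + 1) : ℝ) * v d n = (√(d : ℝ) - u d (n + 1)) * (√(d : ℝ) + u d (n + 1)) := by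
      have : (v d (n + 1) : ℝ) * v d n = d - (u d (n + 1) : ℝ) ^ 2 := by
        exact_mod_cast v_succ_mul hd n
      linear_combination this - hs
    have hlt : (quot d n : ℝ) * v d n < u d n + √(d : ℝ) := by
      refine lt_of_le_of_ne ?_ fun h => (irrational_sqrt hd).ne_int (quot d n * v d n - u d n) ?_
      · rw [← le_div_iff₀ hv, hq]
        exact Int.floor_le _
      · push_cast
        linarith
    have hgt : (u d n : ℝ) + √(d : ℝ) < (quot d n + 1) * v d n := by
      rw [← div_lt_iff₀ hv, hq]
      exact Int.lt_floor_add_one _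
    have hA : √(d : ℝ) - u d (n + 1) < v d n := by rw [hu']; linarith
    have hB : (0 : ℝ) < √(d : ℝ) - u d (n + 1) := by rw [hu']; linarith
    have hC : (v d n : ℝ) < √(d : ℝ) + u d (n + 1) := by
      rw [hu']
      nlinarith
    refine ⟨?_, by linarith, ?_, ?_⟩
    · refine pos_of_mul_pos_left (b := (v d n : ℝ)) ?_ hv.le
      rw [hv']
      exact mul_pos hB (hv.trans hC)
    · refine lt_of_mul_lt_mul_right (a := (v d n : ℝ)) ?_ hv.le
      rw [hv']
      exact mul_lt_mul_of_pos_left hC hB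
    · refine lt_of_mul_lt_mul_right (a := (v d n : ℝ)) ?_ hv.le
      rw [hv', mul_comm]
      exact mul_lt_mul_of_pos_left hA (hv.trans hC)

theorem v_pos {d : ℕ} (hd : ¬ IsSquare d) (n : ℕ) : 0 < v d n := by
  exact_mod_cast (reduced hd n).1

theorem one_le_quot {d : ℕ} (hd : ¬ IsSquare d) (n : ℕ) : 1 ≤ quot d n := by
  obtain ⟨hv, hu, h1, h2⟩ := reduced hd n
  rw [quot_eq_floor hd, Int.le_floor, le_div_iff₀ hv]
  push_cast
  linarith

/-- The algorithm runs backwards: `⌊x_n⌋` is also the integer part of `-1 / x_{n+1}'`, which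
equals `(u_{n+1} + √d) / v_n`. -/
theorem quot_eq_floor_succ {d : ℕ} (hd : ¬ IsSquare d) (n : ℕ) :
    quot d n = ⌊(u d (n + 1) + √(d : ℝ)) / v d n⌋ := by
  obtain ⟨hv, hu, h1, h2⟩ := reduced hd n
  have hu' : (u d (n + 1) : ℝ) = quot d n * v d n - u d n := by exact_mod_cast u_succ d n
  symm
  rw [Int.floor_eq_iff, le_div_iff₀ hv, div_lt_iff₀ hv, hu']
  constructor <;> linarith

/-! ### Periodicity -/

theorem quot_congr {d : ℕ} (hd : ¬ IsSquare d) {m n : ℕ} (hu : u d m = u d n)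
    (hv : v d m = v d n) : quot d m = quot d n := by
  rw [quot_eq_floor hd, quot_eq_floor hd, hu, hv]

theorem uv_succ_congr {d : ℕ} (hd : ¬ IsSquare d) {m n : ℕ}
    (h : u d m = u d n ∧ v d m = v d n) :
    u d (m + 1) = u d (n + 1) ∧ v d (m + 1) = v d (n + 1) := by
  have hu : u d (m + 1) = u d (n + 1) := by
    rw [u_succ, u_succ, quot_congr hd h.1 h.2, h.1, h.2]
  refine ⟨hu, mul_right_cancel₀ (v_pos hd n).ne' ?_⟩
  rw [v_succ_mul hd, ← hu, ← v_succ_mul hd, h.2]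

theorem uv_congr_of_succ {d : ℕ} (hd : ¬ IsSquare d) {m n : ℕ}
    (h : u d (m + 1) = u d (n + 1) ∧ v d (m + 1) = v d (n + 1)) :
    u d m = u d n ∧ v d m = v d n := by
  have hv : v d m = v d n := mul_left_cancel₀ (v_pos hd (n + 1)).ne' <| by
    rw [v_succ_mul hd, ← h.1, ← v_succ_mul hd, h.2]
  have hq : quot d m = quot d n := by
    rw [quot_eq_floor_succ hd, quot_eq_floor_succ hd, h.1, hv]
  have h1 := u_succ d m
  have h2 := u_succ d n
  rw [hq, hv] at h1
  exact ⟨by linarith [h.1], hv⟩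

theorem u_eq_of_v_eq_one {d : ℕ} (hd : ¬ IsSquare d) {m : ℕ} (h : v d m = 1) :
    u d m = ⌊√(d : ℝ)⌋ := by
  obtain ⟨-, hu, h1, -⟩ := reduced hd m
  rw [h] at h1
  push_cast at h1
  symm
  rw [Int.floor_eq_iff]
  constructor <;> linarith

/-- If `v_m = 1` then `x_m = x_0`, so `m` is a period of `(u_n, v_n)`. -/
theorem uv_add_of_v_eq_one {d : ℕ} (hd : ¬ IsSquare d) {m : ℕ} (h : v d m = 1) (n : ℕ) :
    u d (n + m) = u d n ∧ v d (n + m) = v d n := by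
  induction n with
  | zero => rw [Nat.zero_add, u_zero, v_zero]; exact ⟨u_eq_of_v_eq_one hd h, h⟩
  | succ n ih => rw [Nat.add_right_comm]; exact uv_succ_congr hd ih

theorem isPeriod_of_v_eq_one {d : ℕ} (hd : ¬ IsSquare d) {m : ℕ} (hm : 0 < m)
    (h : v d m = 1) : IsPeriod √(d : ℝ) m := by
  refine ⟨hm, 1, fun n hn => ?_⟩
  obtain ⟨n, rfl⟩ := Nat.exists_eq_add_of_le' hn
  rw [Nat.add_right_comm, partialQuotient_sqrt_succ hd, partialQuotient_sqrt_succ hd,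
    Nat.add_right_comm]
  have h1 := uv_add_of_v_eq_one hd h (n + 1)
  exact quot_congr hd h1.1 h1.2

/-- One step of the algorithm for `x_n = (u_n + √d) / v_n`. -/
theorem completeQuotient_step {d : ℕ} (hd : ¬ IsSquare d) (n : ℕ) :
    ((u d n + √(d : ℝ)) / v d n - quot d n) * ((u d (n + 1) + √(d : ℝ)) / v d (n + 1)) = 1 := by
  have hs : √(d : ℝ) ^ 2 = d := Real.sq_sqrt (Nat.cast_nonneg d)
  have h0 := (reduced hd n).1.ne'
  have h1 := (reduced hd (n + 1)).1.ne'
  have hu' : (u d (n + 1) : ℝ) = quot d n * v d n - u d n := by exact_mod_cast u_succ d n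
  have hv' : (v d (n + 1) : ℝ) * v d n = d - (u d (n + 1) : ℝ) ^ 2 := by
    exact_mod_cast v_succ_mul hd n
  field_simp
  linear_combination hs - hv' + (u d (n + 1) + √(d : ℝ)) * hu'

/-- Two sequences of real numbers produced by the continued fraction algorithm with the same
integer parts have the same terms. The two-step contraction
`|x_n - y_n| ≤ |x_{n+2} - y_{n+2}| / 4` comes from `x_n x_{n+1} = a_n x_{n+1} + 1 ≥ 2`. -/
theorem eq_of_same_quotients {x y : ℕ → ℝ} {A : ℕ → ℝ} (hA : ∀ n, 1 ≤ A n)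
    (hx : ∀ n, A n ≤ x n ∧ x n < A n + 1) (hy : ∀ n, A n ≤ y n ∧ y n < A n + 1)
    (hx' : ∀ n, (x n - A n) * x (n + 1) = 1) (hy' : ∀ n, (y n - A n) * y (n + 1) = 1) (n : ℕ) :
    x n = y n := by
  have step : ∀ n, |x n - y n| * (x (n + 1) * y (n + 1)) = |x (n + 1) - y (n + 1)| := by
    intro n
    have h1 := (hA (n + 1)).trans (hx (n + 1)).1
    have h2 := (hA (n + 1)).trans (hy (n + 1)).1
    rw [← abs_of_pos (show 0 < x (n + 1) * y (n + 1) by positivity), ← abs_mul,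
      abs_sub_comm (x (n + 1))]
    congr 1
    linear_combination y (n + 1) * hx' n - x (n + 1) * hy' n
  have two : ∀ n, 4 * |x n - y n| ≤ |x (n + 2) - y (n + 2)| := by
    intro n
    have a1 := (hA (n + 1)).trans (hx (n + 1)).1
    have a2 := (hA (n + 1)).trans (hy (n + 1)).1
    have b1 := (hA (n + 2)).trans (hx (n + 2)).1
    have b2 := (hA (n + 2)).trans (hy (n + 2)).1
    have hX : 2 ≤ x (n + 1) * x (n + 2) := by nlinarith [hx' (n + 1), hA (n + 1)]
    have hY : 2 ≤ y (n + 1) * y (n + 2) := by nlinarith [hy' (n + 1), hA (n + 1)]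
    rw [← step (n + 1), ← step n]
    have : 4 ≤ (x (n + 1) * x (n + 2)) * (y (n + 1) * y (n + 2)) := by nlinarith
    calc 4 * |x n - y n| ≤
          ((x (n + 1) * x (n + 2)) * (y (n + 1) * y (n + 2))) * |x n - y n| :=
        mul_le_mul_of_nonneg_right this (abs_nonneg _)
      _ = _ := by ring
  have bound : ∀ k n, 4 ^ k * |x n - y n| ≤ 1 := by
    intro k
    induction k with
    | zero =>
      intro n
      rw [pow_zero, one_mul, abs_le]
      constructor <;> linarith [(hx n).1, (hx n).2, (hy n).1, (hy n).2]
    | succ k ih =>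
      intro n
      calc (4 : ℝ) ^ (k + 1) * |x n - y n| = 4 ^ k * (4 * |x n - y n|) := by ring
        _ ≤ 4 ^ k * |x (n + 2) - y (n + 2)| :=
          mul_le_mul_of_nonneg_left (two n) (by positivity)
        _ ≤ 1 := ih _
  by_contra hne
  have hpos : 0 < |x n - y n| := abs_pos.mpr (sub_ne_zero.mpr hne)
  obtain ⟨k, hk⟩ := pow_unbounded_of_one_lt (1 / |x n - y n|) (by norm_num : (1 : ℝ) < 4)
  rw [div_lt_iff₀ hpos] at hk
  exact absurd (bound k n) (not_le.mpr hk)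

theorem uv_eq_of_completeQuotient_eq {d : ℕ} (hd : ¬ IsSquare d) {m n : ℕ}
    (h : (u d m + √(d : ℝ)) / v d m = (u d n + √(d : ℝ)) / v d n) :
    u d m = u d n ∧ v d m = v d n := by
  rw [div_eq_div_iff (reduced hd m).1.ne' (reduced hd n).1.ne'] at h
  have hv : v d m = v d n := by
    by_contra hne
    have hne' : ((v d n - v d m : ℤ) : ℝ) ≠ 0 := by
      exact_mod_cast sub_ne_zero.mpr (Ne.symm hne)
    refine (irrational_sqrt hd).ne_rat ((u d n * v d m - u d m * v d n : ℤ) / (v d n - v d m : ℤ)) ?_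
    push_cast at hne' ⊢
    rw [eq_div_iff hne']
    linear_combination h
  refine ⟨?_, hv⟩
  rw [hv] at h
  have := mul_right_cancel₀ (reduced hd n).1.ne' h
  exact_mod_cast add_right_cancel this

/-- An eventual period of the partial quotients of `√d` is a pure period of `(x_n)`: eventually
equal partial quotients force equal complete quotients, and the algorithm runs backwards. -/
theorem v_eq_one_of_isPeriod {d : ℕ} (hd : ¬ IsSquare d) {T : ℕ} (hT : IsPeriod √(d : ℝ) T) :
    v d T = 1 := by
  obtain ⟨-, n₀, h⟩ := hT
  have hq : ∀ n, quot d (n₀ + 1 + n + T) = quot d (n₀ + 1 + n) := by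
    intro n
    have := h (n₀ + n + 1) (by omega)
    rw [partialQuotient_sqrt_succ hd, Nat.add_right_comm, partialQuotient_sqrt_succ hd] at this
    convert this using 2 <;> ring
  have hfl : ∀ n, (quot d n : ℝ) ≤ (u d n + √(d : ℝ)) / v d n ∧
      (u d n + √(d : ℝ)) / v d n < quot d n + 1 := fun n => by
    rw [quot_eq_floor hd]
    exact ⟨Int.floor_le _, Int.lt_floor_add_one _⟩
  have key := uv_eq_of_completeQuotient_eq hd <| eq_of_same_quotients
    (x := fun n => (u d (n₀ + 1 + n + T) + √(d : ℝ)) / v d (n₀ + 1 + n + T))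
    (y := fun n => (u d (n₀ + 1 + n) + √(d : ℝ)) / v d (n₀ + 1 + n))
    (A := fun n => quot d (n₀ + 1 + n)) (fun n => by exact_mod_cast one_le_quot hd _)
    (fun n => by rw [← hq]; exact hfl _) (fun n => hfl _)
    (fun n => by
      rw [← hq, ← add_assoc, Nat.add_right_comm _ 1 T]
      exact completeQuotient_step hd _)
    (fun n => completeQuotient_step hd _) 0
  have back : ∀ k, u d (k + T) = u d k ∧ v d (k + T) = v d k →
      u d T = u d 0 ∧ v d T = v d 0 := by
    intro k
    induction k with
    | zero => rw [Nat.zero_add]; exact id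
    | succ k ih =>
      rw [Nat.add_right_comm]
      exact fun h => ih (uv_congr_of_succ hd h)
  exact (back _ key).2

theorem v_minPeriod {d : ℕ} (hd : ¬ IsSquare d) : v d (minPeriod √(d : ℝ)) = 1 := by
  rcases Set.eq_empty_or_nonempty {T : ℕ | IsPeriod √(d : ℝ) T} with h | h
  · -- Without any period, `minPeriod` takes the value `0`, and `v_0 = 1`.
    rw [minPeriod, h, Nat.sInf_empty, v_zero]
  · exact v_eq_one_of_isPeriod hd (Nat.sInf_mem h)

theorem uv_add_mul_minPeriod {d : ℕ} (hd : ¬ IsSquare d) (n l : ℕ) :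
    u d (n + l * minPeriod √(d : ℝ)) = u d n ∧ v d (n + l * minPeriod √(d : ℝ)) = v d n := by
  induction l with
  | zero => simp
  | succ l ih =>
    have := uv_add_of_v_eq_one hd (v_minPeriod hd) (n + l * minPeriod √(d : ℝ))
    rwa [ih.1, ih.2, add_assoc, ← Nat.succ_mul] at this

theorem minPeriod_pos {d : ℕ} (hd : ¬ IsSquare d) {m : ℕ} (hm : 0 < m) (h : v d m = 1) :
    0 < minPeriod √(d : ℝ) :=
  (Nat.sInf_mem (s := {T : ℕ | IsPeriod √(d : ℝ) T}) ⟨m, isPeriod_of_v_eq_one hd hm h⟩).1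

theorem v_eq_one_iff_minPeriod_dvd {d : ℕ} (hd : ¬ IsSquare d) (m : ℕ) :
    v d m = 1 ↔ minPeriod √(d : ℝ) ∣ m := by
  constructor
  · intro h
    rcases Nat.eq_zero_or_pos m with rfl | hm
    · exact dvd_zero _
    have hT := minPeriod_pos hd hm h
    refine Nat.dvd_of_mod_eq_zero (Nat.eq_zero_of_not_pos fun hpos => ?_)
    have hr := (uv_add_mul_minPeriod hd (m % minPeriod √(d : ℝ)) (m / minPeriod √(d : ℝ))).2
    rw [Nat.mod_add_div', h] at hr
    exact absurd (Nat.sInf_le (isPeriod_of_v_eq_one hd hpos hr.symm) : minPeriod √(d : ℝ) ≤ _)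
      (not_le.mpr (Nat.mod_lt _ hT))
  · rintro ⟨l, rfl⟩
    have := (uv_add_mul_minPeriod hd 0 l).2
    rwa [Nat.zero_add, mul_comm] at this

/-! ### Centres of symmetry -/

/-- If `v_m ∣ u_m`, the conjugate of `x_m` is `2 u_m / v_m - x_m`, so that `⌊x_m⌋ = 2 u_m / v_m`. -/
theorem u_succ_eq_of_dvd {d : ℕ} (hd : ¬ IsSquare d) {m : ℕ} (h : v d m ∣ u d m) :
    u d (m + 1) = u d m := by
  obtain ⟨c, hc⟩ := h
  obtain ⟨hv, hu, h1, -⟩ := reduced hd m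
  have hcR : (u d m : ℝ) = v d m * c := by exact_mod_cast hc
  have hq : quot d m = 2 * c := by
    rw [quot_eq_floor hd, Int.floor_eq_iff, le_div_iff₀ hv, div_lt_iff₀ hv]
    push_cast
    constructor <;> linarith
  rw [u_succ, hq, hc]
  ring

/-- If `v_m ∣ u_m`, the sequences are symmetric about `m`, by the reversibility of the
algorithm. -/
theorem uv_symm {d : ℕ} (hd : ¬ IsSquare d) {m : ℕ} (h : v d m ∣ u d m) (j i : ℕ)
    (hij : i + j = m) : v d (m + j) = v d i ∧ u d (m + j + 1) = u d i := by
  induction j generalizing i with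
  | zero => subst hij; exact ⟨rfl, u_succ_eq_of_dvd hd h⟩
  | succ j ih =>
    obtain ⟨hv, hu⟩ := ih (i + 1) (by omega)
    have hv' : v d (m + (j + 1)) = v d i := mul_right_cancel₀ (v_pos hd (i + 1)).ne' <| by
      rw [← hv, ← add_assoc, v_succ_mul hd, hu, hv, mul_comm, ← v_succ_mul hd]
    refine ⟨hv', ?_⟩
    have hq : quot d (m + (j + 1)) = quot d i := by
      rw [quot_eq_floor hd, quot_eq_floor_succ hd, hv', ← add_assoc, hu]
    rw [u_succ, hq, hv', ← add_assoc, hu, u_succ]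
    ring

/-- Besides the multiples of the period `T`, the sequences can only have a centre of symmetry
at the indices congruent to `T / 2` modulo an even `T`. -/
theorem exists_eq_half_add_mul {d : ℕ} (hd : ¬ IsSquare d) {m : ℕ} (h : v d m ∣ u d m)
    (h1 : v d m ≠ 1) : Even (minPeriod √(d : ℝ)) ∧
      ∃ l, m = minPeriod √(d : ℝ) / 2 + l * minPeriod √(d : ℝ) := by
  have h2 : v d (m + m) = 1 := (uv_symm hd h m 0 (Nat.zero_add m)).1
  obtain ⟨k, hk⟩ := (v_eq_one_iff_minPeriod_dvd hd _).mp h2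
  have hndvd := (v_eq_one_iff_minPeriod_dvd hd m).not.mp h1
  set T := minPeriod √(d : ℝ)
  rcases Nat.even_or_odd' k with ⟨l, rfl | rfl⟩
  · exact absurd ⟨l, by linarith⟩ hndvd
  · have hT : Even T := by
      have : Even (T * (2 * l + 1)) := hk ▸ ⟨m, rfl⟩
      rcases Nat.even_mul.mp this with h | h
      · exact h
      · exact absurd h (by simp)
    refine ⟨hT, l, ?_⟩
    obtain ⟨N, hN⟩ := hT
    rw [hN] at hk ⊢
    rw [← two_mul, Nat.mul_div_cancel_left _ two_pos]
    linarith

/-! ### Convergents -/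

/-- The integers `p_{m-1}` and `q_{m-1}`, with `p_{-1} = 1` and `q_{-1} = 0` at `m = 0`. -/
noncomputable def conv (d : ℕ) : ℕ → ℤ × ℤ
  | 0 => (1, 0)
  | 1 => (⌊√(d : ℝ)⌋, 1)
  | m + 2 => quot d (m + 1) • conv d (m + 1) + conv d m

/-- The numerator `p_{m-1}` of a convergent of `√d`, as an integer. -/
noncomputable def num (d m : ℕ) : ℤ := (conv d m).1

/-- The denominator `q_{m-1}` of a convergent of `√d`, as an integer. -/
noncomputable def den (d m : ℕ) : ℤ := (conv d m).2

theorem num_add_two (d m : ℕ) :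
    num d (m + 2) = quot d (m + 1) * num d (m + 1) + num d m := rfl

theorem den_add_two (d m : ℕ) :
    den d (m + 2) = quot d (m + 1) * den d (m + 1) + den d m := rfl

theorem contsAux_sqrt {d : ℕ} (hd : ¬ IsSquare d) (m : ℕ) :
    (GenContFract.of √(d : ℝ)).contsAux m = ⟨(num d m : ℝ), (den d m : ℝ)⟩ := by
  induction m using Nat.twoStepInduction with
  | zero => simp [GenContFract.contsAux, num, den, conv]
  | one => simp [GenContFract.contsAux, num, den, conv, GenContFract.of_h_eq_floor]
  | more m ih1 ih2 =>
    obtain ⟨s, hs, hb⟩ := stream_sqrt_succ hd m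
    rw [GenContFract.contsAux,
      GenContFract.get?_of_eq_some_of_succ_get?_intFractPair_stream hs]
    simp only [ih1, ih2, hb, GenContFract.nextConts, GenContFract.nextNum, GenContFract.nextDen,
      num_add_two, den_add_two]
    push_cast
    simp

theorem p_eq_num {d : ℕ} (hd : ¬ IsSquare d) (n : ℕ) : p d n = num d (n + 1) :=
  congrArg GenContFract.Pair.a (contsAux_sqrt hd (n + 1))

theorem q_eq_den {d : ℕ} (hd : ¬ IsSquare d) (n : ℕ) : q d n = den d (n + 1) :=
  congrArg GenContFract.Pair.b (contsAux_sqrt hd (n + 1))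

theorem den_nonneg_and_pos_succ {d : ℕ} (hd : ¬ IsSquare d) (m : ℕ) :
    0 ≤ den d m ∧ 0 < den d (m + 1) := by
  induction m with
  | zero => simp [den, conv]
  | succ m ih =>
    refine ⟨ih.2.le, ?_⟩
    rw [den_add_two]
    nlinarith [one_le_quot hd (m + 1)]

theorem num_nonneg {d : ℕ} (hd : ¬ IsSquare d) (m : ℕ) : 0 ≤ num d m := by
  induction m using Nat.twoStepInduction with
  | zero => simp [num, conv]
  | one => exact Int.floor_nonneg.mpr (Real.sqrt_nonneg _)
  | more m ih1 ih2 =>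
    rw [num_add_two]
    nlinarith [one_le_quot hd (m + 1)]

theorem num_mul_den_sub (d m : ℕ) :
    num d (m + 1) * den d m - den d (m + 1) * num d m = (-1) ^ (m + 1) := by
  induction m with
  | zero => simp [num, den, conv]
  | succ m ih =>
    rw [num_add_two, den_add_two, pow_succ, ← ih]
    ring

theorem isCoprime_num_den (d m : ℕ) : IsCoprime (num d (m + 1)) (den d (m + 1)) := by
  refine ⟨(-1) ^ (m + 1) * den d m, -(-1) ^ (m + 1) * num d m, ?_⟩
  have h : ((-1 : ℤ) ^ (m + 1)) * (-1) ^ (m + 1) = 1 := by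
    rw [← mul_pow]
    simp
  linear_combination (-1) ^ (m + 1) * num_mul_den_sub d m + h

/-- The rational and the irrational part of the identity
`√d (x_n q_{n-1} + q_{n-2}) = x_n p_{n-1} + p_{n-2}`, multiplied by `v_n`, at `n = m + 1`. -/
theorem num_den_eq {d : ℕ} (hd : ¬ IsSquare d) (m : ℕ) :
    num d (m + 1) = u d (m + 1) * den d (m + 1) + v d (m + 1) * den d m ∧
      d * den d (m + 1) = u d (m + 1) * num d (m + 1) + v d (m + 1) * num d m := by
  induction m with
  | zero =>
    have hq : quot d 0 = 2 * ⌊√(d : ℝ)⌋ := by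
      rw [quot_eq_floor hd, u_zero, v_zero, Int.cast_one, div_one, Int.floor_intCast_add, two_mul]
    have hu : u d 1 = ⌊√(d : ℝ)⌋ := by
      rw [u_succ, hq, u_zero, v_zero]
      ring
    have hv := v_succ_mul hd 0
    rw [v_zero, Nat.zero_add, hu] at hv
    simp only [num, den, conv, Nat.zero_add, hu]
    exact ⟨by ring, by linear_combination -hv⟩
  | succ m ih =>
    obtain ⟨h1, h2⟩ := ih
    have hv0 := (v_pos hd (m + 1)).ne'
    have hv := v_succ_mul hd (m + 1)
    have hu := u_succ d (m + 1)
    rw [num_add_two, den_add_two]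
    constructor
    · refine mul_left_cancel₀ hv0 ?_
      linear_combination (-den d (m + 1)) * hv - h2 + u d (m + 2) * h1 -
        (num d (m + 1) - u d (m + 2) * den d (m + 1)) * hu
    · refine mul_left_cancel₀ hv0 ?_
      linear_combination (-num d (m + 1)) * hv - d * h1 + u d (m + 2) * h2 -
        (d * den d (m + 1) - u d (m + 2) * num d (m + 1)) * hu

theorem num_sq_sub_mul_den_sq {d : ℕ} (hd : ¬ IsSquare d) (m : ℕ) :
    num d (m + 1) ^ 2 - d * den d (m + 1) ^ 2 = (-1) ^ (m + 1) * v d (m + 1) := by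
  obtain ⟨h1, h2⟩ := num_den_eq hd m
  linear_combination num d (m + 1) * h1 - den d (m + 1) * h2 +
    v d (m + 1) * num_mul_den_sub d m

/-! ### Small values of `X² - d Y²` -/

/-- A primitive solution of `X² - d Y² = c` with `|c| < √d` satisfies the hypothesis of Legendre's
theorem in the sharp form `|√d - X / Y| < 1 / (Y (2 Y - 1))`, which is symmetric in the sign of
`c`. -/
theorem contfracLegendre_ass {d : ℕ} {X Y c : ℤ} (hX : 0 ≤ X) (hY : 1 ≤ Y) (hXY : IsCoprime X Y)
    (hc : X ^ 2 - d * Y ^ 2 = c) (hcd : c ^ 2 < d) :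
    Real.ContfracLegendre.Ass √(d : ℝ) X Y := by
  have hs : √(d : ℝ) ^ 2 = d := Real.sq_sqrt (Nat.cast_nonneg d)
  have hXR : (0 : ℝ) ≤ X := by exact_mod_cast hX
  have hYR : (1 : ℝ) ≤ Y := by exact_mod_cast hY
  have hcR : (X : ℝ) ^ 2 - d * (Y : ℝ) ^ 2 = c := by exact_mod_cast hc
  have hcdR : (c : ℝ) ^ 2 < d := by exact_mod_cast hcd
  have hd1 : (1 : ℝ) ≤ d := by
    have : (0 : ℤ) < d := lt_of_le_of_lt (sq_nonneg c) hcd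
    exact_mod_cast this
  have hd0 : 1 ≤ √(d : ℝ) := Real.one_le_sqrt.mpr hd1
  have hcabs : |(c : ℝ)| < √(d : ℝ) := Real.lt_sqrt_of_sq_lt (by rwa [sq_abs])
  have hfac : (√(d : ℝ) * Y - X) * (√(d : ℝ) * Y + X) = -c := by
    linear_combination (Y : ℝ) ^ 2 * hs - hcR
  have hXlow : (Y - 1) * √(d : ℝ) < X := by
    refine lt_of_pow_lt_pow_left₀ 2 hXR ?_
    have h1 := (abs_lt.mp hcabs).1
    have h2 : √(d : ℝ) ≤ d := by nlinarith
    rw [mul_pow, hs]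
    nlinarith
  have hsum : 0 < √(d : ℝ) * Y + X := by positivity
  refine ⟨hXY, fun h => ?_, ?_⟩
  · subst h
    by_contra hle
    push Not at hle
    have := (abs_lt.mp hcabs).2
    push_cast at hfac
    nlinarith
  · have hY0 : (0 : ℝ) < Y := by linarith
    have h2Y : (0 : ℝ) < 2 * Y - 1 := by linarith
    have hdiff : |√(d : ℝ) - X / Y| = |(c : ℝ)| / (Y * (√(d : ℝ) * Y + X)) := by
      rw [← abs_neg (c : ℝ), ← hfac, abs_mul, abs_of_pos hsum,
        mul_div_mul_right _ _ hsum.ne']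
      nth_rewrite 3 [← abs_of_pos hY0]
      rw [← abs_div, sub_div, mul_div_cancel_right₀ _ hY0.ne']
    rw [hdiff, div_lt_iff₀ (by positivity), inv_mul_eq_div, lt_div_iff₀ (by positivity)]
    nlinarith [abs_nonneg (c : ℝ), mul_lt_mul_of_pos_right hcabs h2Y]

/-- By Legendre's theorem, primitive solutions of `X² - d Y² = c` with `|c| < √d` are convergents
of `√d`, term by term, both fractions being in lowest terms. -/
theorem exists_eq_num_den {d : ℕ} (hd : ¬ IsSquare d) {X Y c : ℤ} (hX : 0 ≤ X) (hY : 1 ≤ Y)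
    (hXY : IsCoprime X Y) (hc : X ^ 2 - d * Y ^ 2 = c) (hcd : c ^ 2 < d) :
    ∃ n, X = num d (n + 1) ∧ Y = den d (n + 1) := by
  have hass := contfracLegendre_ass hX hY hXY hc hcd
  lift Y to ℕ using by omega
  obtain ⟨n, hn⟩ := Real.exists_rat_eq_convergent' hass
  refine ⟨n, ?_⟩
  have hpos := (den_nonneg_and_pos_succ hd n).2
  have hY0 : (0 : ℤ) < Y := by omega
  have hR : (X : ℝ) / (Y : ℤ) = num d (n + 1) / den d (n + 1) := by
    have h1 : (((X / Y : ℚ)) : ℝ) = (GenContFract.of √(d : ℝ)).convs n := by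
      rw [Real.convs_eq_convergent, hn]
    rw [GenContFract.conv_eq_num_div_den] at h1
    change _ = p d n / q d n at h1
    rw [p_eq_num hd, q_eq_den hd] at h1
    rw [← h1]
    push_cast
    rfl
  have hQ : (X : ℚ) / (Y : ℤ) = num d (n + 1) / den d (n + 1) := by exact_mod_cast hR
  have := (Rat.div_int_inj hY0 hpos (Int.isCoprime_iff_nat_coprime.mp hXY)
    (Int.isCoprime_iff_nat_coprime.mp (isCoprime_num_den d n)) hQ)
  exact this

/-! ### The equation `c x² - e y² = ±1` with `c < e` -/

/-- For `c < √d`, solving `c x² - e y² = ε` amounts to solving `(c x)² - d y² = ε c`, and the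
solutions of the latter are convergents. -/
theorem solution_iff {c e d : ℕ} (hd : ¬ IsSquare d) (hde : d = c * e) (hc : 2 ≤ c)
    (hce : c < e) {ε : ℤ} (hε : ε = 1 ∨ ε = -1) (x y : ℕ) :
    (c : ℤ) * x ^ 2 - e * y ^ 2 = ε ↔
      ∃ n, (-1) ^ (n + 1) = ε ∧ v d (n + 1) = c ∧ v d (n + 1) ∣ u d (n + 1) ∧
        (c : ℤ) * x = num d (n + 1) ∧ (y : ℤ) = den d (n + 1) := by
  have hε2 : ε * ε = 1 := by rcases hε with rfl | rfl <;> norm_num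
  have hc0 : (c : ℤ) ≠ 0 := by omega
  have hdz : (d : ℤ) = c * e := by exact_mod_cast hde
  constructor
  · intro h
    have hy : y ≠ 0 := by
      rintro rfl
      have : (c : ℤ) ∣ 1 := ⟨x ^ 2 * ε, by push_cast at h; linear_combination -ε * h - hε2⟩
      have := Int.le_of_dvd one_pos this
      omega
    have hXY : IsCoprime ((c : ℤ) * x) y :=
      ⟨x * ε, -(e * y * ε), by linear_combination ε * h + hε2⟩
    have hXc : ((c : ℤ) * x) ^ 2 - d * (y : ℤ) ^ 2 = ε * c := by
      rw [hdz]
      linear_combination (c : ℤ) * h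
    have hcd : (ε * c) ^ 2 < (d : ℤ) := by
      have : (c : ℤ) < e := by exact_mod_cast hce
      rw [hdz, mul_pow, pow_two ε, hε2]
      nlinarith
    obtain ⟨n, hn1, hn2⟩ := exists_eq_num_den hd (by positivity) (by omega) hXY hXc hcd
    have hnorm := num_sq_sub_mul_den_sq hd n
    rw [← hn1, ← hn2, hXc] at hnorm
    have hv := v_pos hd (n + 1)
    -- The signs agree because `c` and `v_{n+1}` are positive.
    have hboth : (-1) ^ (n + 1) = ε ∧ v d (n + 1) = c := by
      rcases neg_one_pow_eq_or ℤ (n + 1) with h1 | h1 <;> rw [h1] at hnorm ⊢ <;>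
        rcases hε with rfl | rfl <;> constructor <;> omega
    refine ⟨n, hboth.1, hboth.2, ?_, hn1, hn2⟩
    rw [hboth.2]
    have h1 := (num_den_eq hd n).1
    rw [← hn1, ← hn2, hboth.2] at h1
    exact hXY.of_mul_left_left.dvd_of_dvd_mul_right
      (⟨x - den d n, by linear_combination -h1⟩ : (c : ℤ) ∣ u d (n + 1) * y)
  · rintro ⟨n, h1, h2, -, h4, h5⟩
    have hnorm := num_sq_sub_mul_den_sq hd n
    rw [h1, h2, ← h4, ← h5, hdz] at hnorm
    refine mul_left_cancel₀ hc0 ?_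
    linear_combination hnorm

/-- The solutions of `c x² - e y² = ε` are given by the centres of symmetry `m` of the
expansion with `v_m = c`; all of them are congruent to `T / 2` modulo the period `T`. -/
theorem solution_iff_minPeriod {c e d : ℕ} (hd : ¬ IsSquare d) (hde : d = c * e) (hc : 2 ≤ c)
    (hce : c < e) {ε : ℤ} (hε : ε = 1 ∨ ε = -1) {T N : ℕ} (hT : T = minPeriod √(d : ℝ))
    (hN : N = T / 2) (x y : ℕ) :
    (c : ℤ) * x ^ 2 - e * y ^ 2 = ε ↔
      (Even T ∧ (-1) ^ N = ε ∧ v d N = c ∧ v d N ∣ u d N) ∧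
      ∃ l : ℕ, (c : ℝ) * x = p d (N - 1 + l * T) ∧ (y : ℝ) = q d (N - 1 + l * T) := by
  have hper : ∀ l, u d (N + l * T) = u d N ∧ v d (N + l * T) = v d N := fun l => by
    rw [hT]; exact uv_add_mul_minPeriod hd N l
  have hpow : Even T → ∀ l, (-1 : ℤ) ^ (N + l * T) = (-1) ^ N := fun hT l => by
    rw [pow_add, (hT.mul_left l).neg_one_pow, mul_one]
  rw [solution_iff hd hde hc hce hε]
  constructor
  · rintro ⟨n, h1, h2, h3, h4, h5⟩
    obtain ⟨hev, l, hl⟩ := exists_eq_half_add_mul hd h3 (by omega)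
    rw [← hT, ← hN] at hl
    rw [← hT] at hev
    have hN0 : N ≠ 0 := by
      rintro rfl
      have : T = 0 := by obtain ⟨k, rfl⟩ := hev; omega
      rw [this] at hl
      omega
    have hn : n = N - 1 + l * T := by omega
    rw [hl, hpow hev] at h1
    rw [hl, (hper l).2] at h2
    rw [hl, (hper l).1, (hper l).2] at h3
    refine ⟨⟨hev, h1, h2, h3⟩, l, ?_⟩
    rw [p_eq_num hd, q_eq_den hd, ← hn, ← h4, ← h5]
    push_cast
    exact ⟨rfl, rfl⟩
  · rintro ⟨⟨hev, h1, h2, h3⟩, l, h4, h5⟩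
    have hN0 : N ≠ 0 := by
      rintro rfl
      rw [v_zero] at h2
      omega
    have hn : N - 1 + l * T + 1 = N + l * T := by omega
    rw [p_eq_num hd] at h4
    rw [q_eq_den hd] at h5
    refine ⟨N - 1 + l * T, ?_, ?_, ?_, by exact_mod_cast h4, by exact_mod_cast h5⟩ <;> rw [hn]
    · rw [hpow hev, h1]
    · rw [(hper l).2, h2]
    · rwa [(hper l).1, (hper l).2]

/-- When the criterion holds, each index `N - 1 + l T` does give a solution: the numerator of
the convergent is divisible by `c`. -/
theorem exists_nat_of_criterion {c d : ℕ} (hd : ¬ IsSquare d) (hc : 2 ≤ c) {T N : ℕ}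
    (hT : T = minPeriod √(d : ℝ)) (h2 : v d N = c) (h3 : v d N ∣ u d N) (l : ℕ) :
    ∃ x y : ℕ, (c : ℝ) * x = p d (N - 1 + l * T) ∧ (y : ℝ) = q d (N - 1 + l * T) := by
  have hN0 : N ≠ 0 := by
    rintro rfl
    rw [v_zero] at h2
    omega
  have hn : N - 1 + l * T + 1 = N + l * T := by omega
  have hper := uv_add_mul_minPeriod hd N l
  rw [← hT] at hper
  have hdvd : (c : ℤ) ∣ num d (N - 1 + l * T + 1) := by
    rw [(num_den_eq hd _).1, hn, hper.1, hper.2, ← h2]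
    exact dvd_add (h3.mul_right _) (dvd_mul_right _ _)
  obtain ⟨x, hx⟩ := hdvd
  have hx0 : 0 ≤ x := by
    have := num_nonneg hd (N - 1 + l * T + 1)
    rw [hx] at this
    exact nonneg_of_mul_nonneg_right this (by omega)
  lift x to ℕ using hx0
  obtain ⟨y, hy⟩ := Int.eq_ofNat_of_zero_le (den_nonneg_and_pos_succ hd (N - 1 + l * T)).2.le
  refine ⟨x, y, ?_, ?_⟩
  · rw [p_eq_num hd, hx]
    push_cast
    rfl
  · rw [q_eq_den hd, hy]
    push_cast
    rfl

theorem exists_solution_iff {c e d : ℕ} (hd : ¬ IsSquare d) (hde : d = c * e) (hc : 2 ≤ c)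
    (hce : c < e) {ε : ℤ} (hε : ε = 1 ∨ ε = -1) {T N : ℕ} (hT : T = minPeriod √(d : ℝ))
    (hN : N = T / 2) :
    (∃ x y : ℕ, (c : ℤ) * x ^ 2 - e * y ^ 2 = ε) ↔
      Even T ∧ (-1) ^ N = ε ∧ v d N = c ∧ v d N ∣ u d N := by
  constructor
  · rintro ⟨x, y, h⟩
    exact ((solution_iff_minPeriod hd hde hc hce hε hT hN x y).mp h).1
  · intro h
    obtain ⟨x, y, hxy⟩ := exists_nat_of_criterion hd hc hT h.2.2.1 h.2.2.2 0
    exact ⟨x, y, (solution_iff_minPeriod hd hde hc hce hε hT hN x y).mpr ⟨h, 0, hxy⟩⟩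

theorem even_and_neg_one_pow_half_eq_one_iff (T : ℕ) :
    Even T ∧ (-1 : ℤ) ^ (T / 2) = 1 ↔ T ≡ 0 [MOD 4] := by
  rw [neg_one_pow_eq_one_iff_even (by norm_num), Nat.even_iff, Nat.even_iff, Nat.ModEq]
  omega

theorem even_and_neg_one_pow_half_eq_neg_one_iff (T : ℕ) :
    Even T ∧ (-1 : ℤ) ^ (T / 2) = -1 ↔ T ≡ 2 [MOD 4] := by
  rw [neg_one_pow_eq_neg_one_iff_odd (by norm_num), Nat.even_iff, Nat.odd_iff, Nat.ModEq]
  omega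

end SqrtContFrac

theorem mainTheorem1 (a b : ℕ) (ha : 2 ≤ a) (hb : 2 ≤ b) (hab : Nat.Coprime a b)
    (d : ℕ) (hd : d = a * b) (hsq : ¬ IsSquare d)
    (T : ℕ) (hT : T = SqrtContFrac.minPeriod √(d : ℝ))
    (N : ℕ) (hN : N = T / 2) :
    (a < b →
      ((SqrtContFrac.solutions a b).Nonempty ↔
        T ≡ 0 [MOD 4] ∧ SqrtContFrac.v d N = a ∧ SqrtContFrac.v d N ∣ SqrtContFrac.u d N) ∧
      (T ≡ 0 [MOD 4] ∧ SqrtContFrac.v d N = a ∧ SqrtContFrac.v d N ∣ SqrtContFrac.u d N →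
        (fun s : ℕ × ℕ => ((s.1 : ℝ), (s.2 : ℝ))) '' SqrtContFrac.solutions a b =
          {z : ℝ × ℝ | ∃ l : ℕ, z =
            (SqrtContFrac.p d (N - 1 + l * T) / a, SqrtContFrac.q d (N - 1 + l * T))})) ∧
    (b < a →
      ((SqrtContFrac.solutions a b).Nonempty ↔
        T ≡ 2 [MOD 4] ∧ SqrtContFrac.v d N = b ∧ SqrtContFrac.v d N ∣ SqrtContFrac.u d N) ∧
      (T ≡ 2 [MOD 4] ∧ SqrtContFrac.v d N = b ∧ SqrtContFrac.v d N ∣ SqrtContFrac.u d N →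
        (fun s : ℕ × ℕ => ((s.1 : ℝ), (s.2 : ℝ))) '' SqrtContFrac.solutions a b =
          {z : ℝ × ℝ | ∃ l : ℕ, z =
            (SqrtContFrac.q d (N - 1 + l * T), SqrtContFrac.p d (N - 1 + l * T) / b)})) ∧
    (Odd T → ¬ (SqrtContFrac.solutions a b).Nonempty) := by
  have case1 : a < b → ((SqrtContFrac.solutions a b).Nonempty ↔
      T ≡ 0 [MOD 4] ∧ SqrtContFrac.v d N = a ∧ SqrtContFrac.v d N ∣ SqrtContFrac.u d N) := by
    intro h
    rw [← SqrtContFrac.even_and_neg_one_pow_half_eq_one_iff, ← hN, and_assoc,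
      ← SqrtContFrac.exists_solution_iff hsq hd ha h (Or.inl rfl) hT hN]
    exact Prod.exists
  -- Multiplied by `-1`, the equation reads `b y² - a x² = -1`.
  have hswap : ∀ x y : ℕ, (x, y) ∈ SqrtContFrac.solutions a b ↔
      (b : ℤ) * y ^ 2 - a * x ^ 2 = -1 := fun x y => by
    change (a : ℤ) * x ^ 2 - b * y ^ 2 = 1 ↔ _
    constructor <;> intro h <;> linarith
  have hd' : d = b * a := hd.trans (mul_comm a b)
  have case2 : b < a → ((SqrtContFrac.solutions a b).Nonempty ↔
      T ≡ 2 [MOD 4] ∧ SqrtContFrac.v d N = b ∧ SqrtContFrac.v d N ∣ SqrtContFrac.u d N) := by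
    intro h
    rw [← SqrtContFrac.even_and_neg_one_pow_half_eq_neg_one_iff, ← hN, and_assoc,
      ← SqrtContFrac.exists_solution_iff hsq hd' hb h (Or.inr rfl) hT hN, exists_comm]
    simp only [← hswap]
    exact Prod.exists
  have ha0 : (a : ℝ) ≠ 0 := by positivity
  have hb0 : (b : ℝ) ≠ 0 := by positivity
  refine ⟨fun h => ⟨case1 h, fun hcrit => ?_⟩, fun h => ⟨case2 h, fun hcrit => ?_⟩,
    fun hodd hne => ?_⟩
  · have key := SqrtContFrac.solution_iff_minPeriod hsq hd ha h (Or.inl rfl) hT hN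
    ext z
    constructor
    · rintro ⟨⟨x, y⟩, hxy, rfl⟩
      obtain ⟨-, l, h1, h2⟩ := (key x y).mp hxy
      exact ⟨l, Prod.ext (eq_div_of_mul_eq ha0 ((mul_comm _ _).trans h1)) h2⟩
    · rintro ⟨l, rfl⟩
      obtain ⟨x, y, h1, h2⟩ :=
        SqrtContFrac.exists_nat_of_criterion hsq ha hT hcrit.2.1 hcrit.2.2 l
      have hc' := hcrit
      rw [← SqrtContFrac.even_and_neg_one_pow_half_eq_one_iff, ← hN, and_assoc] at hc'
      exact ⟨(x, y), (key x y).mpr ⟨hc', l, h1, h2⟩,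
        Prod.ext (eq_div_of_mul_eq ha0 ((mul_comm _ _).trans h1)) h2⟩
  · have key := SqrtContFrac.solution_iff_minPeriod hsq hd' hb h (Or.inr rfl) hT hN
    ext z
    constructor
    · rintro ⟨⟨x, y⟩, hxy, rfl⟩
      obtain ⟨-, l, h1, h2⟩ := (key y x).mp ((hswap x y).mp hxy)
      exact ⟨l, Prod.ext h2 (eq_div_of_mul_eq hb0 ((mul_comm _ _).trans h1))⟩
    · rintro ⟨l, rfl⟩
      obtain ⟨y, x, h1, h2⟩ :=
        SqrtContFrac.exists_nat_of_criterion hsq hb hT hcrit.2.1 hcrit.2.2 l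
      have hc' := hcrit
      rw [← SqrtContFrac.even_and_neg_one_pow_half_eq_neg_one_iff, ← hN, and_assoc] at hc'
      exact ⟨(x, y), (hswap x y).mpr ((key y x).mpr ⟨hc', l, h1, h2⟩),
        Prod.ext h2 (eq_div_of_mul_eq hb0 ((mul_comm _ _).trans h1))⟩
  · -- The coefficients differ, as `d` is not a square, so that one of the criteria applies.
    rw [Nat.odd_iff] at hodd
    rcases lt_trichotomy a b with h | h | h
    · have := ((case1 h).mp hne).1
      rw [Nat.ModEq] at this
      omega
    · exact hsq ⟨a, by rw [hd, h]⟩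
    · have := ((case2 h).mp hne).1
      rw [Nat.ModEq] at this
      omega
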